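/- Let $\Omega\subset\mathbb{R}^d$ be a bounded open set with $C^2$ boundary, that is, near each boundary point $\Omega$ is, in suitable orthonormal coordinates, the region lying strictly above the graph of a $C^2$ function of $d-1$ variables. Let $p\in(1,\infty)$ and $\gamma\in(0,1]$. For a real-valued function $h$ on $\Omega$ (or, more generally, one with values in a real normed space, such as the space of symmetric $d\times d$ matrices with any norm, in which case measurability is strong measurability), and $z\in\Omega$ put $$h^\#_\gamma(z)=\sup_{r>0}\left(\frac{1}{|B_r(z)\cap\Omega|^2}\int_{B_r(z)\cap\Omega}\int_{B_r(z)\cap\Omega}|h(x)-h(y)|^\gamma\,dx\,dy\right)^{1/\gamma}\in[0,\infty],$$ where $B_r(z)=\{y\in\mathbb{R}^d:|y-z|<r\}$, $|\Gamma|$ is the volume of a set $\Gamma\subset\mathbb{R}^d$, and $|h(x)|$, $|h(x)-h(y)|$ are taken in the norm of the space of values of $h$. Then there is a finite constant $N$, depending only on $d$, $p$, $\gamma$ and $\Omega$, such that for every $h\in L_p(\Omega)$ $$\|h\|_{L_p(\Omega)}\le N\,\|h^\#_\gamma\|_{L_p(\Omega)}+N\left(\int_\Omega|h|^\gamma\,dx\right)^{1/\gamma}.$$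 -/

import Mathlib

open MeasureTheory
open scoped NNReal ENNReal

/-- `Ω` is an open subset of `ℝ^d` with `C²` boundary: near each boundary point `x₀`, in a suitable
orthonormal system of coordinates, `Ω` is the part of a ball about `x₀` lying strictly above the
graph of a `C²` function `ψ`. Here `e` is the unit vector of the vertical axis, `⟪e, x⟫` is the
vertical coordinate of `x`, and `x - ⟪e, x⟫ e` is the projection of `x` on the hyperplane of the
other `d - 1` coordinates; only the values of `ψ` on that hyperplane matter. -/
structure IsC2Domain {d : ℕ} (Ω : Set (EuclideanSpace ℝ (Fin d))) : Prop where
  isOpen : IsOpen Ω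
  locally_graph : ∀ x₀ ∈ frontier Ω,
    ∃ (r : ℝ) (e : EuclideanSpace ℝ (Fin d)) (ψ : EuclideanSpace ℝ (Fin d) → ℝ),
      0 < r ∧ ‖e‖ = 1 ∧ ContDiff ℝ 2 ψ ∧
      Ω ∩ Metric.ball x₀ r =
        {x ∈ Metric.ball x₀ r | ψ (x - inner ℝ e x • e) < inner ℝ e x}

/-- The `γ`-sharp function of `h` relative to `Ω`: the supremum over all radii `r > 0` of the
double mean value (average) of `|h(x) - h(y)|^γ` over `x, y ∈ B_r(z) ∩ Ω`, raised to the power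
`1 / γ`. It takes values in `[0, ∞]`. -/
noncomputable def gammaSharp {d : ℕ} {E : Type*} [NormedAddCommGroup E]
    (Ω : Set (EuclideanSpace ℝ (Fin d))) (γ : ℝ) (h : EuclideanSpace ℝ (Fin d) → E)
    (z : EuclideanSpace ℝ (Fin d)) : ℝ≥0∞ :=
  ⨆ (r : ℝ) (_ : 0 < r),
    (⨍⁻ x, ⨍⁻ y, ‖h x - h y‖ₑ ^ γ ∂volume.restrict (Metric.ball z r ∩ Ω)
      ∂volume.restrict (Metric.ball z r ∩ Ω)) ^ (1 / γ)

open Metric Set Filter Topology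

/-! The exponent γ disappears on passing to v = |h|^γ and q = p/γ > 1. Since | |a|^γ - |b|^γ | ≤ |a
- b|^γ, the ordinary sharp function of v is at most (h^#_γ)^γ. It remains to prove a Fefferman–Stein
inequality for the real function v and the measure μ = Lebesgue measure on Ω, and to take p-th
roots.

Fefferman–Stein rests on two facts. First, μ is doubling at points of Ω
(`IsC2Domain.exists_volume_ball_le`), because the C² boundary gives an interior corkscrew condition.
Second, there is a good-λ inequality (`measure_lt_and_dyadicSharp_le_le`): above the global mean of
|v|, the set where |v| > 2l but v^# ≤ εl has measure at most a multiple of (ε/l) ∫_{|v| > l/2} |v|.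
The layer-cake formula turns this into ∫|v|^q ≤ (sharp and mean terms) + Kε ∫|v|^q, and for small ε
the last term is absorbed because v ∈ L_q. -/

/-- The sharp function of `v` over balls with dyadic radii. -/
noncomputable def dyadicSharp {X : Type*} [PseudoMetricSpace X] [MeasurableSpace X]
    (μ : Measure X) (v : X → ℝ) (z : X) : ℝ≥0∞ :=
  ⨆ k : ℤ, ⨍⁻ x in ball z ((2 : ℝ) ^ k), ⨍⁻ y in ball z ((2 : ℝ) ^ k), ‖v x - v y‖ₑ ∂μ ∂μ

/-! ### Measurability of the dyadic sharp function -/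

theorem measurable_dyadicSharp {X : Type*} [PseudoMetricSpace X] [SecondCountableTopology X]
    [MeasurableSpace X] [OpensMeasurableSpace X] {μ : Measure X} [SFinite μ] {v : X → ℝ}
    (hv : Measurable v) : Measurable (dyadicSharp μ v) := by
  unfold dyadicSharp
  refine Measurable.iSup fun k => ?_
  set r : ℝ := (2 : ℝ) ^ k
  have hμ : Measurable fun z => μ (ball z r) := by
    have hs : MeasurableSet {q : X × X | dist q.2 q.1 < r} :=
      measurableSet_lt (measurable_snd.dist measurable_fst) measurable_const
    exact measurable_measure_prodMk_left hs
  have key : ∀ F : (X × X) → ℝ≥0∞, Measurable F → Measurable fun z : X =>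
      ∫⁻ x in ball z r, F (z, x) ∂μ := by
    intro F hF
    have hs : MeasurableSet {q : X × X | dist q.2 q.1 < r} :=
      measurableSet_lt (measurable_snd.dist measurable_fst) measurable_const
    have := (hF.indicator hs).lintegral_prod_right' (ν := μ)
    convert this using 2 with z
    rw [← lintegral_indicator measurableSet_ball]
    rfl
  have key2 : Measurable fun q : X × X => ∫⁻ y in ball q.1 r, ‖v q.2 - v y‖ₑ ∂μ := by
    have hs : MeasurableSet {q : (X × X) × X | dist q.2 q.1.1 < r} :=
      measurableSet_lt (measurable_snd.dist measurable_fst.fst) measurable_const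
    have hF : Measurable fun q : (X × X) × X => ‖v q.1.2 - v q.2‖ₑ := by fun_prop
    have := (hF.indicator hs).lintegral_prod_right' (ν := μ)
    convert this using 2 with z
    rw [← lintegral_indicator measurableSet_ball]
    rfl
  simp only [setLAverage_eq]
  refine Measurable.div (key (fun q => (∫⁻ y in ball q.1 r, ‖v q.2 - v y‖ₑ ∂μ) / μ (ball q.1 r))
    (key2.div (hμ.comp measurable_fst))) hμ

/-! ### The good-λ inequality -/

section GoodLambda

variable {X : Type*} [MetricSpace X] [SecondCountableTopology X] [MeasurableSpace X]
  {μ : Measure X} [IsFiniteMeasure μ] {v : X → ℝ}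

/-- The mean of |v| over the ball of radius 8·2^k is at most l, so a point with |v| > 2l deviates
from v by at least l on average there. If the exceptional set were large, the double mean
oscillation would exceed what the sharp function allows at any one exceptional point z. -/
theorem measure_inter_closedBall_le_of_dyadicSharp_le (hv : Measurable v) {C : ℝ≥0} {l ε : ℝ≥0∞}
    (hl0 : l ≠ 0) (hlt : l ≠ ∞) {x : X} {k : ℤ}
    (hC : ∀ z, μ (ball z (32 * (2 : ℝ) ^ k)) ≤ C * μ (closedBall x ((2 : ℝ) ^ k)))
    (h0 : μ (closedBall x ((2 : ℝ) ^ k)) ≠ 0)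
    (hav : ∫⁻ y in closedBall x (8 * (2 : ℝ) ^ k), ‖v y‖ₑ ∂μ
      ≤ l * μ (closedBall x (8 * (2 : ℝ) ^ k))) :
    μ ({y | 2 * l < ‖v y‖ₑ ∧ dyadicSharp μ v y ≤ ε * l} ∩ closedBall x (8 * (2 : ℝ) ^ k)) ≤
      C ^ 2 * ε * μ (closedBall x ((2 : ℝ) ^ k)) := by
  set r : ℝ := (2 : ℝ) ^ k with hr
  have hrpos : 0 < r := by positivity
  set G := {y | 2 * l < ‖v y‖ₑ ∧ dyadicSharp μ v y ≤ ε * l}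
  set B8 := closedBall x (8 * r)
  set m := μ (closedBall x r)
  rcases (G ∩ B8).eq_empty_or_nonempty with he | ⟨z, hzG, hzB⟩
  · simp [he]
  -- The factor 32 = 2^5 keeps the radius dyadic and exceeds the 16 needed to contain the closed
  -- ball of radius 8r about x.
  set B := ball z (32 * r)
  have hBs : B8 ⊆ B := by
    intro y hy
    have h1 : dist y x ≤ 8 * r := hy
    have h2 : dist z x ≤ 8 * r := hzB
    have := dist_triangle_right y z x
    simp only [B, mem_ball]
    linarith
  have hB0 : μ B ≠ 0 := fun h => h0 (measure_mono_null
    ((closedBall_subset_closedBall (by linarith)).trans hBs) h)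
  have hBt : μ B ≠ ∞ := measure_ne_top _ _
  have hmt : m ≠ ∞ := measure_ne_top _ _
  have hmB8 : m ≤ μ B8 := measure_mono (closedBall_subset_closedBall (by linarith))
  have hFm : Measurable fun y => ∫⁻ w in B8, ‖v y - v w‖ₑ ∂μ := by
    have : Measurable fun q : X × X => ‖v q.1 - v q.2‖ₑ := by fun_prop
    exact this.lintegral_prod_right' (ν := μ.restrict B8)
  have hup : ∫⁻ y in B8, ∫⁻ w in B8, ‖v y - v w‖ₑ ∂μ ∂μ ≤ ε * l * (μ B * μ B) := by
    have h1 : ⨍⁻ y in B, ⨍⁻ w in B, ‖v y - v w‖ₑ ∂μ ∂μ ≤ ε * l := by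
      have h2 : (32 : ℝ) * r = (2 : ℝ) ^ (k + 5) := by
        rw [zpow_add₀ two_ne_zero, hr]; norm_num; ring
      refine le_trans ?_ hzG.2
      simp only [B, h2]
      exact le_iSup (fun k : ℤ => ⨍⁻ x in ball z ((2 : ℝ) ^ k), ⨍⁻ y in ball z ((2 : ℝ) ^ k),
        ‖v x - v y‖ₑ ∂μ ∂μ) (k + 5)
    simp only [setLAverage_eq] at h1
    have h3 := (ENNReal.div_le_iff hB0 hBt).1 h1
    have h4 : ∫⁻ y in B, ∫⁻ w in B, ‖v y - v w‖ₑ ∂μ ∂μ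
        = (∫⁻ y in B, (∫⁻ w in B, ‖v y - v w‖ₑ ∂μ) / μ B ∂μ) * μ B := by
      simp only [div_eq_mul_inv]
      rw [lintegral_mul_const' _ _ (ENNReal.inv_ne_top.2 hB0), mul_assoc,
        ENNReal.inv_mul_cancel hB0 hBt, mul_one]
    calc _ ≤ ∫⁻ y in B8, ∫⁻ w in B, ‖v y - v w‖ₑ ∂μ ∂μ :=
          lintegral_mono fun y => lintegral_mono_set hBs
      _ ≤ ∫⁻ y in B, ∫⁻ w in B, ‖v y - v w‖ₑ ∂μ ∂μ := lintegral_mono_set hBs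
      _ ≤ _ := by
        rw [h4, ← mul_assoc]
        gcongr
  have hlow : l * μ B8 * μ (G ∩ B8) ≤ ∫⁻ y in B8, ∫⁻ w in B8, ‖v y - v w‖ₑ ∂μ ∂μ := by
    rw [← setLIntegral_const]
    refine (setLIntegral_mono hFm fun y hy => ?_).trans (lintegral_mono_set inter_subset_right)
    have h1 : l * μ B8 + l * μ B8 ≤ (∫⁻ w in B8, ‖v y - v w‖ₑ ∂μ) + l * μ B8 := by
      calc l * μ B8 + l * μ B8 = (2 * l) * μ B8 := by ring
        _ ≤ ‖v y‖ₑ * μ B8 := by gcongr; exact hy.1.1.le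
        _ = ∫⁻ w in B8, ‖v y‖ₑ ∂μ := (setLIntegral_const _ _).symm
        _ ≤ ∫⁻ w in B8, (‖v y - v w‖ₑ + ‖v w‖ₑ) ∂μ := by
          refine lintegral_mono fun w => ?_
          simpa using enorm_add_le (v y - v w) (v w)
        _ = (∫⁻ w in B8, ‖v y - v w‖ₑ ∂μ) + ∫⁻ w in B8, ‖v w‖ₑ ∂μ :=
          lintegral_add_right _ (by fun_prop)
        _ ≤ _ := by gcongr
    exact (ENNReal.add_le_add_iff_right (ENNReal.mul_ne_top hlt (measure_ne_top _ _))).1 h1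
  have h5 : (l * m) * μ (G ∩ B8) ≤ (l * m) * (C ^ 2 * ε * m) := by
    calc (l * m) * μ (G ∩ B8) ≤ l * μ B8 * μ (G ∩ B8) := by gcongr
      _ ≤ ε * l * (μ B * μ B) := hlow.trans hup
      _ ≤ ε * l * ((C * m) * (C * m)) := by gcongr <;> exact hC z
      _ = _ := by ring
  exact (ENNReal.mul_le_mul_iff_right (mul_ne_zero hl0 h0) (ENNReal.mul_ne_top hlt hmt)).1 h5

variable [BorelSpace X]

/-- Lebesgue differentiation along dyadic radii tending to 0. -/
theorem ae_exists_zpow_two_lt_setLIntegral_closedBall [HasBesicovitchCovering X] (hv : Measurable v)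
    (hvi : ∫⁻ x, ‖v x‖ₑ ∂μ ≠ ∞) (l : ℝ≥0∞) :
    ∀ᵐ x ∂μ, l < ‖v x‖ₑ → ∃ k : ℤ, l * μ (closedBall x ((2 : ℝ) ^ k)) <
      ∫⁻ y in closedBall x ((2 : ℝ) ^ k), ‖v y‖ₑ ∂μ := by
  filter_upwards [(Besicovitch.vitaliFamily μ).ae_tendsto_lintegral_div
    (f := fun x => ‖v x‖ₑ) (by fun_prop) hvi] with x hx hlx
  have h1 := (hx.comp (Besicovitch.tendsto_filterAt μ x)).eventually (lt_mem_nhds hlx)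
  have h2 : Tendsto (fun n : ℕ => (2 : ℝ) ^ (-(n : ℤ))) atTop (𝓝[>] 0) := by
    refine tendsto_nhdsWithin_iff.2 ⟨?_, Eventually.of_forall fun n => by
      simp only [mem_Ioi]; positivity⟩
    have := tendsto_pow_atTop_nhds_zero_of_lt_one (r := (1 / 2 : ℝ)) (by norm_num) (by norm_num)
    refine this.congr fun n => ?_
    simp [zpow_neg]
  obtain ⟨n, hn⟩ := (h2.eventually h1).exists
  exact ⟨-(n : ℤ), ENNReal.mul_lt_of_lt_div hn⟩

/-- A stopping-time argument: at almost every point with |v| > l, take the largest dyadic ball on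
which the mean exceeds l. Vitali's lemma selects disjoint stopping balls whose enlargements cover
almost all of the exceptional set; the local estimate is summed over them. -/
theorem measure_lt_and_dyadicSharp_le_le [HasBesicovitchCovering X] {Ω : Set X}
    (hΩ : ∀ᵐ x ∂μ, x ∈ Ω) (hb : Bornology.IsBounded Ω) {C : ℝ≥0}
    (hC : ∀ x ∈ Ω, ∀ z, ∀ r > 0, μ (ball z (32 * r)) ≤ C * μ (closedBall x r))
    (hv : Measurable v) (hvi : ∫⁻ x, ‖v x‖ₑ ∂μ ≠ ∞) {l ε : ℝ≥0∞} (hl0 : l ≠ 0) (hlt : l ≠ ∞)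
    (hl : ∫⁻ x, ‖v x‖ₑ ∂μ ≤ l * μ univ) :
    μ {x | 2 * l < ‖v x‖ₑ ∧ dyadicSharp μ v x ≤ ε * l} ≤
      C ^ 2 * ε * (2 / l * ∫⁻ x in {x | l / 2 < ‖v x‖ₑ}, ‖v x‖ₑ ∂μ) := by
  set G := {x | 2 * l < ‖v x‖ₑ ∧ dyadicSharp μ v x ≤ ε * l}
  set V := {x | l / 2 < ‖v x‖ₑ}
  have hVm : MeasurableSet V := measurableSet_lt measurable_const (by fun_prop)
  let P : X → ℤ → Prop := fun x k => l * μ (closedBall x ((2 : ℝ) ^ k)) <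
      ∫⁻ y in closedBall x ((2 : ℝ) ^ k), ‖v y‖ₑ ∂μ
  obtain ⟨R, hR⟩ := Metric.isBounded_iff.1 hb
  obtain ⟨n, hn⟩ := pow_unbounded_of_one_lt R (one_lt_two (α := ℝ))
  -- A ball larger than the diameter bound carries all of μ, and the global mean is at most l.
  have hPn : ∀ x ∈ Ω, ∀ k, P x k → k ≤ n := by
    intro x hx k hk
    by_contra! hkn
    have hsub : ∀ᵐ y ∂μ, y ∈ closedBall x ((2 : ℝ) ^ k) := by
      filter_upwards [hΩ] with y hy
      have h1 : (2 : ℝ) ^ (n : ℤ) ≤ 2 ^ k := zpow_le_zpow_right₀ one_le_two hkn.le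
      rw [zpow_natCast] at h1
      exact ((hR hy hx).trans hn.le).trans h1
    have h2 : closedBall x ((2 : ℝ) ^ k) =ᵐ[μ] univ := eventuallyEq_univ.2 hsub
    refine absurd hk (not_lt.2 ?_)
    rw [setLIntegral_congr h2, measure_congr h2, setLIntegral_univ]
    exact hl
  have hmax : ∀ x ∈ Ω, (∃ k, P x k) → ∃ k : ℤ, P x k ∧ k ≤ n ∧ ¬ P x (k + 3) := by
    intro x hx hk
    obtain ⟨k, hk1, hk2⟩ := Int.exists_greatest_of_bdd ⟨n, hPn x hx⟩ hk
    exact ⟨k, hk1, hPn x hx k hk1, fun h => by have := hk2 _ h; omega⟩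
  set T : Set X := {x | x ∈ Ω ∧ ∃ k, P x k}
  have hmaxT : ∀ x : X, ∃ k : ℤ, x ∈ T → P x k ∧ k ≤ n ∧ ¬ P x (k + 3) := by
    intro x
    by_cases hx : x ∈ T
    · obtain ⟨k, hk⟩ := hmax x hx.1 hx.2
      exact ⟨k, fun _ => hk⟩
    · exact ⟨0, fun h => absurd h hx⟩
  choose κ hκ using hmaxT
  -- The enlargement factor 8 = 2^3 matches the scale k + 3, where maximality bounds the mean by l.
  obtain ⟨u, huT, hud, hcov⟩ := Vitali.exists_disjoint_subfamily_covering_enlargement_closedBall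
    T (fun x => x) (fun x => (2 : ℝ) ^ κ x) ((2 : ℝ) ^ (n : ℤ))
    (fun x hx => zpow_le_zpow_right₀ one_le_two (hκ x hx).2.1) 8 (by norm_num)
  have hucount : u.Countable := hud.countable_of_nonempty_interior fun x _ =>
    ⟨x, ball_subset_interior_closedBall (mem_ball_self (by positivity))⟩
  have hGT : ∀ᵐ x ∂μ, x ∈ G → x ∈ ⋃ b ∈ u, G ∩ closedBall b (8 * (2 : ℝ) ^ κ b) := by
    filter_upwards [hΩ, ae_exists_zpow_two_lt_setLIntegral_closedBall hv hvi l] with x hx hxk hxG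
    have hlx : l < ‖v x‖ₑ := lt_of_le_of_lt (le_mul_of_one_le_left' one_le_two) hxG.1
    obtain ⟨b, hbu, hbx⟩ := hcov x ⟨hx, hxk hlx⟩
    exact mem_biUnion hbu ⟨hxG, hbx (mem_closedBall_self (by positivity))⟩
  have hb1 : ∀ b ∈ u, μ (G ∩ closedBall b (8 * (2 : ℝ) ^ κ b)) ≤
      C ^ 2 * ε * μ (closedBall b ((2 : ℝ) ^ κ b)) := by
    intro b hbu
    obtain ⟨h1, -, h3⟩ := hκ b (huT hbu)
    refine measure_inter_closedBall_le_of_dyadicSharp_le hv hl0 hlt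
      (fun z => hC b (huT hbu).1 z _ (by positivity)) ?_ ?_
    · intro h0
      simp [P, h0, Measure.restrict_eq_zero.2 h0] at h1
    · have h8 : (2 : ℝ) ^ (κ b + 3) = 8 * 2 ^ κ b := by
        rw [zpow_add₀ two_ne_zero]; norm_num; ring
      simpa only [P, not_lt, h8] using h3
  -- On a stopping ball D the part where |v| ≤ l/2 contributes at most half of l·μ(D), so the rest
  -- of the integral carries the other half.
  have hb2 : ∀ b ∈ u, μ (closedBall b ((2 : ℝ) ^ κ b)) ≤
      2 / l * ∫⁻ y in closedBall b ((2 : ℝ) ^ κ b), ‖v y‖ₑ ∂(μ.restrict V) := by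
    intro b hbu
    set D := closedBall b ((2 : ℝ) ^ κ b)
    have h1 : l * μ D < ∫⁻ y in D, ‖v y‖ₑ ∂μ := (hκ b (huT hbu)).1
    have h2 : ∫⁻ y in D, ‖v y‖ₑ ∂μ ≤
        (∫⁻ y in D, ‖v y‖ₑ ∂(μ.restrict V)) + l / 2 * μ D := by
      rw [← lintegral_inter_add_sdiff _ D hVm, Measure.restrict_restrict measurableSet_closedBall]
      gcongr
      rw [← setLIntegral_const]
      refine (setLIntegral_mono measurable_const fun y hy => ?_).trans
        (lintegral_mono_set sdiff_subset)
      simpa [V] using hy.2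
    have h3 : l / 2 * μ D + l / 2 * μ D ≤
        (∫⁻ y in D, ‖v y‖ₑ ∂(μ.restrict V)) + l / 2 * μ D := by
      rw [← add_mul, ENNReal.add_halves]
      exact h1.le.trans h2
    have h4 := (ENNReal.add_le_add_iff_right (ENNReal.mul_ne_top
      (ENNReal.div_ne_top hlt two_ne_zero) (measure_ne_top μ D))).1 h3
    calc μ D = 2 / l * (l / 2 * μ D) := by
          rw [← mul_assoc, ← ENNReal.inv_div (by simp) (by simp),
            ENNReal.inv_mul_cancel (by simp [hl0]) (ENNReal.div_ne_top hlt two_ne_zero), one_mul]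
      _ ≤ _ := by gcongr
  have := hucount.to_subtype
  calc μ G ≤ μ (⋃ b ∈ u, G ∩ closedBall b (8 * (2 : ℝ) ^ κ b)) := measure_mono_ae hGT
    _ ≤ ∑' b : u, μ (G ∩ closedBall (b : X) (8 * (2 : ℝ) ^ κ b)) := measure_biUnion_le μ hucount _
    _ ≤ ∑' b : u, C ^ 2 * ε * (2 / l *
        ∫⁻ y in closedBall (b : X) ((2 : ℝ) ^ κ b), ‖v y‖ₑ ∂(μ.restrict V)) :=
      ENNReal.tsum_le_tsum fun b => (hb1 b b.2).trans (by gcongr; exact hb2 b b.2)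
    _ = C ^ 2 * ε * (2 / l *
        ∫⁻ y in ⋃ b ∈ u, closedBall b ((2 : ℝ) ^ κ b), ‖v y‖ₑ ∂(μ.restrict V)) := by
      rw [ENNReal.tsum_mul_left, ENNReal.tsum_mul_left,
        lintegral_biUnion hucount (fun _ _ => measurableSet_closedBall) hud]
    _ ≤ _ := mul_le_mul' le_rfl (mul_le_mul' le_rfl (setLIntegral_le_lintegral _ _))

end GoodLambda

/-! ### Layer-cake formula for extended nonnegative functions -/

theorem lintegral_rpow_eq_lintegral_meas_ofReal_lt_mul {X : Type*} [MeasurableSpace X]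
    {μ : Measure X} {f : X → ℝ≥0∞} (hf : Measurable f) (hfin : ∀ᵐ x ∂μ, f x ≠ ∞) {q : ℝ}
    (hq : 0 < q) :
    ∫⁻ x, f x ^ q ∂μ = ENNReal.ofReal q *
      ∫⁻ t in Ioi (0 : ℝ), μ {x | ENNReal.ofReal t < f x} * ENNReal.ofReal (t ^ (q - 1)) := by
  have h := lintegral_rpow_eq_lintegral_meas_lt_mul (μ := μ) (f := fun x => (f x).toReal)
    (Eventually.of_forall fun x => ENNReal.toReal_nonneg) hf.ennreal_toReal.aemeasurable hq
  calc ∫⁻ x, f x ^ q ∂μ = ∫⁻ x, ENNReal.ofReal ((f x).toReal ^ q) ∂μ := by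
        refine lintegral_congr_ae ?_
        filter_upwards [hfin] with x hx
        rw [← ENNReal.ofReal_rpow_of_nonneg ENNReal.toReal_nonneg hq.le, ENNReal.ofReal_toReal hx]
    _ = _ := by
        rw [h]
        congr 1
        refine setLIntegral_congr_fun measurableSet_Ioi fun t ht => ?_
        congr 1
        refine measure_congr ?_
        filter_upwards [hfin] with x hx
        exact propext (ENNReal.ofReal_lt_iff_lt_toReal (le_of_lt ht) hx).symm

theorem measurable_meas_ofReal_lt {X : Type*} [MeasurableSpace X] (μ : Measure X) (f : X → ℝ≥0∞) :
    Measurable fun t : ℝ => μ {x | ENNReal.ofReal t < f x} :=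
  Antitone.measurable fun _ _ hst => measure_mono fun _ hx =>
    (ENNReal.ofReal_le_ofReal hst).trans_lt hx

/-! ### The Fefferman–Stein inequality -/

section FeffermanStein

variable {X : Type*} [MetricSpace X] [SecondCountableTopology X] [MeasurableSpace X]
  [BorelSpace X] [HasBesicovitchCovering X] {μ : Measure X} [IsFiniteMeasure μ]

/-- The good-λ inequality is integrated against t^(q-1). Levels t below the mean a are bounded
trivially and give the first term. In the last term the factor 1/t lowers the power to t^(q-2), so
it is a layer-cake integral of 2|v| with exponent q - 1 for the weighted measure |v|μ. -/
theorem lintegral_enorm_rpow_le_add_dyadicSharp {Ω : Set X}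
    (hΩ : ∀ᵐ x ∂μ, x ∈ Ω) (hb : Bornology.IsBounded Ω) {C : ℝ≥0}
    (hC : ∀ x ∈ Ω, ∀ z, ∀ r > 0, μ (ball z (32 * r)) ≤ C * μ (closedBall x r))
    {q : ℝ} (hq : 1 < q) {v : X → ℝ} (hv : Measurable v) (hvi : ∫⁻ x, ‖v x‖ₑ ∂μ ≠ ∞)
    (hgfin : ∀ᵐ x ∂μ, dyadicSharp μ v x ≠ ∞) {ε : ℝ≥0} (hε : ε ≠ 0) :
    ∫⁻ x, (‖v x‖ₑ / 2) ^ q ∂μ ≤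
      ((∫⁻ x, ‖v x‖ₑ ∂μ) / μ univ) ^ q * μ univ + ∫⁻ x, (dyadicSharp μ v x / ε) ^ q ∂μ +
      ENNReal.ofReal q * (2 * C ^ 2 * ε) * ((ENNReal.ofReal (q - 1))⁻¹ *
        ∫⁻ x, ‖v x‖ₑ * (2 * ‖v x‖ₑ) ^ (q - 1) ∂μ) := by
  rcases eq_or_ne μ 0 with rfl | hμ
  · simp
  have hμ0 : μ univ ≠ 0 := by simpa using hμ
  have hq0 : 0 < q := by linarith
  set a := (∫⁻ x, ‖v x‖ₑ ∂μ) / μ univ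
  have ha : a ≠ ∞ := ENNReal.div_ne_top hvi hμ0
  set ν := μ.withDensity fun x => ‖v x‖ₑ
  have hεt : (ε : ℝ≥0∞) ≠ ∞ := ENNReal.coe_ne_top
  have hε0 : (ε : ℝ≥0∞) ≠ 0 := by simpa using hε
  have hpt : ∀ t ∈ Ioi (0 : ℝ), μ {x | ENNReal.ofReal t < ‖v x‖ₑ / 2} *
      ENNReal.ofReal (t ^ (q - 1)) ≤
      μ {x | ENNReal.ofReal t < a} * ENNReal.ofReal (t ^ (q - 1)) +
      (μ {x | ENNReal.ofReal t < dyadicSharp μ v x / ε} * ENNReal.ofReal (t ^ (q - 1)) +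
      (2 * C ^ 2 * ε) * (ν {x | ENNReal.ofReal t < 2 * ‖v x‖ₑ} *
        ENNReal.ofReal (t ^ (q - 1 - 1)))) := by
    intro t ht
    rw [mem_Ioi] at ht
    rcases lt_or_ge (ENNReal.ofReal t) a with hta | hta
    · refine le_trans ?_ le_self_add
      exact mul_le_mul' (measure_mono fun _ _ => hta) le_rfl
    refine le_trans ?_ le_add_self
    set l := ENNReal.ofReal t
    have hl0 : l ≠ 0 := by simpa [l] using ht
    have hlt : l ≠ ∞ := ENNReal.ofReal_ne_top
    have hgood := measure_lt_and_dyadicSharp_le_le hΩ hb hC hv hvi (ε := ε) hl0 hlt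
      ((ENNReal.div_le_iff hμ0 (measure_ne_top _ _)).1 hta)
    have hνV : ∫⁻ x in {x | l / 2 < ‖v x‖ₑ}, ‖v x‖ₑ ∂μ = ν {x | l < 2 * ‖v x‖ₑ} := by
      have : {x | l / 2 < ‖v x‖ₑ} = {x | l < 2 * ‖v x‖ₑ} := by
        ext x
        simp only [mem_ofPred_eq]
        rw [ENNReal.div_lt_iff (by simp) (by simp), mul_comm]
      rw [this, withDensity_apply _ (measurableSet_lt measurable_const (by fun_prop))]
    have hsub : {x | l < ‖v x‖ₑ / 2} ⊆ {x | l < dyadicSharp μ v x / ε} ∪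
        {x | 2 * l < ‖v x‖ₑ ∧ dyadicSharp μ v x ≤ ε * l} := by
      intro x hx
      by_cases h : l < dyadicSharp μ v x / ε
      · exact Or.inl h
      · refine Or.inr ⟨?_, ?_⟩
        · rw [mul_comm]; exact ENNReal.mul_lt_of_lt_div hx
        · rw [not_lt, ENNReal.div_le_iff hε0 hεt, mul_comm] at h
          exact h
    calc μ {x | l < ‖v x‖ₑ / 2} * ENNReal.ofReal (t ^ (q - 1))
        ≤ (μ {x | l < dyadicSharp μ v x / ε} +
          C ^ 2 * ε * (2 / l * ν {x | l < 2 * ‖v x‖ₑ})) * ENNReal.ofReal (t ^ (q - 1)) := by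
          gcongr
          refine (measure_mono hsub).trans ((measure_union_le _ _).trans ?_)
          rw [← hνV]
          gcongr
      _ = _ := by
          have h1 : ENNReal.ofReal (t ^ (q - 1)) = l * ENNReal.ofReal (t ^ (q - 1 - 1)) := by
            rw [← ENNReal.ofReal_mul ht.le]
            congr 1
            rw [Real.rpow_sub_one ht.ne' (q - 1)]
            field_simp
          rw [add_mul]
          congr 1
          rw [h1, ENNReal.div_eq_inv_mul]
          calc _ = (l⁻¹ * l) * (2 * C ^ 2 * ε * (ν {x | l < 2 * ‖v x‖ₑ} *
              ENNReal.ofReal (t ^ (q - 1 - 1)))) := by ring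
            _ = _ := by rw [ENNReal.inv_mul_cancel hl0 hlt, one_mul]
  have hmeas : ∀ f : X → ℝ≥0∞, Measurable fun t : ℝ =>
      μ {x | ENNReal.ofReal t < f x} * ENNReal.ofReal (t ^ (q - 1)) := fun f =>
    (measurable_meas_ofReal_lt μ f).mul (by fun_prop)
  have hvm : Measurable fun x => ‖v x‖ₑ := by fun_prop
  have hgm := measurable_dyadicSharp (μ := μ) hv
  have e1 := lintegral_rpow_eq_lintegral_meas_ofReal_lt_mul (μ := μ)
    (f := fun x => ‖v x‖ₑ / 2) (hvm.div_const _)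
    (Eventually.of_forall fun x => ENNReal.div_ne_top enorm_ne_top two_ne_zero) hq0
  have e2 := lintegral_rpow_eq_lintegral_meas_ofReal_lt_mul (μ := μ)
    (f := fun _ => a) measurable_const (Eventually.of_forall fun x => ha) hq0
  have e3 := lintegral_rpow_eq_lintegral_meas_ofReal_lt_mul (μ := μ)
    (f := fun x => dyadicSharp μ v x / ε) (hgm.div_const _)
    (hgfin.mono fun x hx => ENNReal.div_ne_top hx hε0) hq0
  have e4 := lintegral_rpow_eq_lintegral_meas_ofReal_lt_mul (μ := ν)
    (f := fun x => 2 * ‖v x‖ₑ) (hvm.const_mul _)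
    (Eventually.of_forall fun x => ENNReal.mul_ne_top ENNReal.ofNat_ne_top enorm_ne_top)
    (sub_pos.2 hq)
  rw [lintegral_const] at e2
  rw [lintegral_withDensity_eq_lintegral_mul _ hvm ((hvm.const_mul _).pow_const _)] at e4
  simp only [Pi.mul_apply] at e4
  have hq1 : ENNReal.ofReal (q - 1) ≠ 0 := by simpa using hq
  rw [e1, e2, e3, e4, ← mul_assoc _ (ENNReal.ofReal (q - 1)),
    ENNReal.inv_mul_cancel hq1 ENNReal.ofReal_ne_top, one_mul, mul_assoc (ENNReal.ofReal q),
    ← mul_add, ← mul_add]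
  gcongr
  refine (setLIntegral_mono' measurableSet_Ioi hpt).trans (le_of_eq ?_)
  rw [lintegral_add_left (hmeas fun _ => a),
    lintegral_add_left (hmeas fun x => dyadicSharp μ v x / ε),
    lintegral_const_mul' _ _ (by finiteness), add_assoc]

/-- The Fefferman–Stein inequality on a bounded set with a doubling measure. -/
theorem exists_lintegral_enorm_rpow_le_dyadicSharp (μ : Measure X) [IsFiniteMeasure μ] {Ω : Set X}
    (hΩ : ∀ᵐ x ∂μ, x ∈ Ω) (hb : Bornology.IsBounded Ω) {C : ℝ≥0}
    (hC : ∀ x ∈ Ω, ∀ z, ∀ r > 0, μ (ball z (32 * r)) ≤ C * μ (closedBall x r))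
    {q : ℝ} (hq : 1 < q) :
    ∃ N : ℝ≥0, ∀ v : X → ℝ, Measurable v → ∫⁻ x, ‖v x‖ₑ ∂μ ≠ ∞ → ∫⁻ x, ‖v x‖ₑ ^ q ∂μ ≠ ∞ →
      ∫⁻ x, ‖v x‖ₑ ^ q ∂μ ≤
        N * ∫⁻ x, dyadicSharp μ v x ^ q ∂μ + N * (∫⁻ x, ‖v x‖ₑ ∂μ) ^ q := by
  rcases eq_or_ne μ 0 with rfl | hμ
  · exact ⟨0, by simp⟩
  have hμ0 : μ univ ≠ 0 := by simpa using hμ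
  have hq0 : 0 < q := by linarith
  -- Kε is the coefficient of ∫|v|^q on the right once both sides are multiplied by 2^q; ε is chosen
  -- to make it at most 1/2.
  set K : ℝ≥0 := 2 ^ q * (q.toNNReal * (2 * C ^ 2)) * ((q - 1).toNNReal⁻¹ * 2 ^ (q - 1)) with hK
  set ε : ℝ≥0 := (2 * (K + 1))⁻¹ with hεd
  have hε : ε ≠ 0 := by positivity
  have hKε : K * ε ≤ 2⁻¹ := by
    rw [hεd, mul_inv, ← mul_assoc, mul_comm K, mul_assoc]
    refine mul_le_of_le_one_right' ?_
    rw [← div_eq_mul_inv]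
    exact div_le_one_of_le₀ (by simp) (by simp)
  have hAfin : ((μ univ)⁻¹ ^ q * μ univ) ≠ ∞ :=
    ENNReal.mul_ne_top (ENNReal.rpow_ne_top_of_nonneg hq0.le (ENNReal.inv_ne_top.2 hμ0))
      (measure_ne_top _ _)
  set A : ℝ≥0 := ((μ univ)⁻¹ ^ q * μ univ).toNNReal
  have hA : (A : ℝ≥0∞) = (μ univ)⁻¹ ^ q * μ univ := ENNReal.coe_toNNReal hAfin
  -- The summand 1 makes D visibly nonzero, which settles the case of an infinite sharp integral.
  set D : ℝ≥0 := 2 * 2 ^ q * (ε⁻¹) ^ q + 2 * 2 ^ q * A + 1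
  refine ⟨D, fun v hv hvi hvq => ?_⟩
  set I := ∫⁻ x, ‖v x‖ₑ ^ q ∂μ
  set S := ∫⁻ x, dyadicSharp μ v x ^ q ∂μ
  set M := ∫⁻ x, ‖v x‖ₑ ∂μ
  rcases eq_or_ne S ∞ with hS | hS
  · have : (D : ℝ≥0∞) ≠ 0 := by
      have : D ≠ 0 := by positivity
      simpa using this
    rw [hS, ENNReal.mul_top this, top_add]
    exact le_top
  have hvm : Measurable fun x => ‖v x‖ₑ := by fun_prop
  have hgm := measurable_dyadicSharp (μ := μ) hv
  have hgfin : ∀ᵐ x ∂μ, dyadicSharp μ v x ≠ ∞ := by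
    filter_upwards [ae_lt_top (hgm.pow_const q) hS] with x hx h
    simp [h, ENNReal.top_rpow_of_pos hq0] at hx
  have h := lintegral_enorm_rpow_le_add_dyadicSharp hΩ hb hC hq hv hvi hgfin hε
  have e1 : ∫⁻ x, (‖v x‖ₑ / 2) ^ q ∂μ = (2⁻¹ : ℝ≥0∞) ^ q * I := by
    simp only [ENNReal.div_eq_inv_mul, ENNReal.mul_rpow_of_nonneg _ _ hq0.le]
    exact lintegral_const_mul _ (hvm.pow_const _)
  have e2 : ∫⁻ x, (dyadicSharp μ v x / ε) ^ q ∂μ = ((ε⁻¹ : ℝ≥0) : ℝ≥0∞) ^ q * S := by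
    simp only [ENNReal.div_eq_inv_mul, ENNReal.mul_rpow_of_nonneg _ _ hq0.le,
      ENNReal.coe_inv hε]
    exact lintegral_const_mul _ (hgm.pow_const _)
  have e3 : ∫⁻ x, ‖v x‖ₑ * (2 * ‖v x‖ₑ) ^ (q - 1) ∂μ = 2 ^ (q - 1) * I := by
    rw [← lintegral_const_mul _ (hvm.pow_const _)]
    refine lintegral_congr fun x => ?_
    rw [ENNReal.mul_rpow_of_nonneg _ _ (sub_nonneg.2 hq.le), mul_left_comm]
    congr 1
    nth_rw 1 [← ENNReal.rpow_one ‖v x‖ₑ]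
    rw [← ENNReal.rpow_add_of_nonneg _ _ zero_le_one (sub_nonneg.2 hq.le)]
    congr 1; ring
  have e4 : (M / μ univ) ^ q * μ univ = A * M ^ q := by
    rw [hA, ENNReal.div_eq_inv_mul, ENNReal.mul_rpow_of_nonneg _ _ hq0.le]
    ring
  rw [e1, e2, e3, e4] at h
  have h22 : (2 : ℝ≥0∞) ^ q * 2⁻¹ ^ q = 1 := by
    rw [← ENNReal.mul_rpow_of_nonneg _ _ hq0.le, ENNReal.mul_inv_cancel (by simp) (by simp),
      ENNReal.one_rpow]
  have hKc : (K : ℝ≥0∞) = 2 ^ q * (ENNReal.ofReal q * (2 * C ^ 2)) *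
      ((ENNReal.ofReal (q - 1))⁻¹ * 2 ^ (q - 1)) := by
    have h1 : (q - 1).toNNReal ≠ 0 := by simpa using hq
    rw [hK]
    push_cast [ENNReal.coe_inv h1, ENNReal.coe_rpow_of_nonneg _ hq0.le,
      ENNReal.coe_rpow_of_nonneg _ (sub_nonneg.2 hq.le)]
    rfl
  have hI : I ≤ 2 ^ q * (A * M ^ q + ((ε⁻¹ : ℝ≥0) : ℝ≥0∞) ^ q * S) + 2⁻¹ * I := by
    calc I = 2 ^ q * (2⁻¹ ^ q * I) := by rw [← mul_assoc, h22, one_mul]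
      _ ≤ 2 ^ q * (A * M ^ q + ((ε⁻¹ : ℝ≥0) : ℝ≥0∞) ^ q * S +
        ENNReal.ofReal q * (2 * C ^ 2 * ε) *
          ((ENNReal.ofReal (q - 1))⁻¹ * (2 ^ (q - 1) * I))) := by gcongr
      _ = 2 ^ q * (A * M ^ q + ((ε⁻¹ : ℝ≥0) : ℝ≥0∞) ^ q * S) + (K * ε : ℝ≥0) * I := by
        rw [ENNReal.coe_mul, hKc]; ring
      _ ≤ _ := by
        gcongr
        have : ((K * ε : ℝ≥0) : ℝ≥0∞) ≤ ((2⁻¹ : ℝ≥0) : ℝ≥0∞) := ENNReal.coe_le_coe.2 hKε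
        simpa using this
  have hhalf : 2⁻¹ * I + 2⁻¹ * I = I := by
    rw [← add_mul, ENNReal.inv_two_add_inv_two, one_mul]
  -- Absorption: cancelling I/2 requires the a priori finiteness `hvq`.
  have hI2 : 2⁻¹ * I ≤ 2 ^ q * (A * M ^ q + ((ε⁻¹ : ℝ≥0) : ℝ≥0∞) ^ q * S) := by
    refine (ENNReal.add_le_add_iff_right
      (ENNReal.mul_ne_top (ENNReal.inv_ne_top.2 two_ne_zero) hvq)).1 ?_
    rw [hhalf]
    exact hI
  calc I = 2 * (2⁻¹ * I) := by
        rw [← mul_assoc, ENNReal.mul_inv_cancel (by simp) (by simp), one_mul]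
    _ ≤ 2 * (2 ^ q * (A * M ^ q + ((ε⁻¹ : ℝ≥0) : ℝ≥0∞) ^ q * S)) := by gcongr
    _ = ((2 * 2 ^ q * (ε⁻¹) ^ q : ℝ≥0) : ℝ≥0∞) * S + ((2 * 2 ^ q * A : ℝ≥0) : ℝ≥0∞) * M ^ q := by
      push_cast [ENNReal.coe_rpow_of_nonneg _ hq0.le]
      ring
    _ ≤ _ := by
      gcongr
      · exact le_add_right le_self_add
      · exact le_add_right le_add_self

end FeffermanStein

/-! ### Corkscrew condition and doubling -/

theorem IsC2Domain.exists_ball_subset_of_mem_closure {d : ℕ}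
    {Ω : Set (EuclideanSpace ℝ (Fin d))} (hΩ : IsC2Domain Ω) {x₀ : EuclideanSpace ℝ (Fin d)}
    (hx₀ : x₀ ∈ closure Ω) :
    ∃ ρ > 0, ∃ δ > 0, ∀ z ∈ Ω ∩ ball x₀ ρ, ∀ s, 0 < s → s ≤ ρ →
      ∃ w, ball w (δ * s) ⊆ ball z s ∩ Ω := by
  by_cases hx : x₀ ∈ Ω
  · obtain ⟨R, hR, hRs⟩ := Metric.isOpen_iff.1 hΩ.isOpen x₀ hx
    refine ⟨R / 2, by positivity, 1, one_pos, fun z hz s hs hsR => ⟨z, ?_⟩⟩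
    rw [one_mul]
    refine subset_inter subset_rfl ((ball_subset_ball' ?_).trans hRs)
    have := mem_ball.1 hz.2
    linarith
  have hfr : x₀ ∈ frontier Ω := by
    rw [hΩ.isOpen.frontier_eq]
    exact ⟨hx₀, hx⟩
  obtain ⟨r, e, ψ, hr, he, hψ, hΩe⟩ := hΩ.locally_graph x₀ hfr
  set P : EuclideanSpace ℝ (Fin d) → EuclideanSpace ℝ (Fin d) := fun x => x - inner ℝ e x • e
  have hPsub : ∀ x y, ‖P x - P y‖ ≤ 2 * ‖x - y‖ := by
    intro x y
    have h1 : P x - P y = (x - y) - inner ℝ e (x - y) • e := by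
      simp only [P, inner_sub_right, sub_smul]; abel
    have h2 := norm_inner_le_norm (𝕜 := ℝ) e (x - y)
    rw [he, one_mul] at h2
    rw [h1]
    refine (norm_sub_le _ _).trans ?_
    rw [norm_smul, he, mul_one]
    linarith
  have hPc : Continuous P := by fun_prop
  obtain ⟨K, t, ht, hK⟩ := (hψ.contDiffAt (x := P x₀)).of_le one_le_two |>.exists_lipschitzOnWith
  obtain ⟨η, hη, hηt⟩ := Metric.mem_nhds_iff.1 (hPc.continuousAt.preimage_mem_nhds ht)
  -- The halving keeps points within ρ of z inside both the chart and the region where ψ is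
  -- Lipschitz along the projection.
  set ρ := min r η / 2
  have hρ : 0 < ρ := by positivity
  have hρr : 2 * ρ ≤ r := by have := min_le_left r η; simp only [ρ]; linarith
  have hρη : 2 * ρ ≤ η := by have := min_le_right r η; simp only [ρ]; linarith
  -- Raising z by s/2 gains height s/2 above the graph. Moving a further δs costs at most 2Kδs in ψ
  -- (the projection is crudely 2-Lipschitz) and δs in height; δ makes the total exactly s/2.
  set δ : ℝ := (2 * (2 * K + 1))⁻¹
  have hδ : 0 < δ := by positivity
  have hδK : (2 * K + 1) * δ = 1 / 2 := by simp only [δ]; field_simp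
  have hδ2 : δ ≤ 1 / 2 := by
    have : 0 ≤ (K : ℝ) * δ := by positivity
    linarith
  refine ⟨ρ, hρ, δ, hδ, fun z hz s hs hsρ => ⟨z + (s / 2) • e, fun y hy => ?_⟩⟩
  have hyw : ‖y - (z + (s / 2) • e)‖ < δ * s := by rwa [mem_ball, dist_eq_norm] at hy
  have hee : inner ℝ e e = (1 : ℝ) := by rw [real_inner_self_eq_norm_sq, he]; norm_num
  have hPw : P (z + (s / 2) • e) = P z := by
    simp only [P, inner_add_right, inner_smul_right, hee, add_smul, mul_one]; abel
  have hδs : δ * s ≤ s / 2 := by nlinarith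
  have hyz : dist y z < s := by
    rw [dist_eq_norm]
    have h1 : y - z = (y - (z + (s / 2) • e)) + (s / 2) • e := by abel
    rw [h1]
    refine (norm_add_le _ _).trans_lt ?_
    rw [norm_smul, he, mul_one, Real.norm_of_nonneg (by positivity)]
    linarith
  have hzx : dist z x₀ < ρ := hz.2
  have hyx : dist y x₀ < 2 * ρ := by linarith [dist_triangle y z x₀]
  refine ⟨hyz, ?_⟩
  have hzr : z ∈ ball x₀ r := by rw [mem_ball]; linarith
  have hzΩ : ψ (P z) < inner ℝ e z := by
    have : z ∈ Ω ∩ ball x₀ r := ⟨hz.1, hzr⟩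
    rw [hΩe] at this
    exact this.2
  suffices h : y ∈ Ω ∩ ball x₀ r from h.1
  rw [hΩe]
  refine ⟨by rw [mem_ball]; linarith, ?_⟩
  have hPy : P y ∈ t := hηt (by rw [mem_ball]; linarith)
  have hPz : P z ∈ t := hηt (by rw [mem_ball]; linarith)
  have h1 : ψ (P y) - ψ (P z) ≤ 2 * K * (δ * s) := by
    have h2 := hK.dist_le_mul _ hPy _ hPz
    rw [Real.dist_eq, dist_eq_norm] at h2
    have h3 := hPsub y (z + (s / 2) • e)
    rw [hPw] at h3
    calc ψ (P y) - ψ (P z) ≤ K * ‖P y - P z‖ := (le_abs_self _).trans h2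
      _ ≤ K * (2 * (δ * s)) := by gcongr; linarith
      _ = _ := by ring
  have h4 : inner ℝ e z + s / 2 - δ * s < inner ℝ e y := by
    have h5 := norm_inner_le_norm (𝕜 := ℝ) e (y - (z + (s / 2) • e))
    rw [he, one_mul, inner_sub_right, inner_add_right, inner_smul_right, hee, mul_one,
      Real.norm_eq_abs] at h5
    have := (abs_le.1 h5).1
    linarith
  have h6 : 2 * K * (δ * s) + δ * s = s / 2 := by
    calc _ = ((2 * K + 1) * δ) * s := by ring
      _ = _ := by rw [hδK]; ring
  change ψ (P y) < _
  linarith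

/-- A bounded `C²` domain satisfies the interior corkscrew condition, uniformly up to a fixed
scale. -/
theorem IsC2Domain.exists_forall_ball_subset {d : ℕ}
    {Ω : Set (EuclideanSpace ℝ (Fin d))} (hΩ : IsC2Domain Ω) (hb : Bornology.IsBounded Ω) :
    ∃ ρ > 0, ∃ δ > 0, ∀ z ∈ Ω, ∀ s, 0 < s → s ≤ ρ → ∃ w, ball w (δ * s) ⊆ ball z s ∩ Ω := by
  have hcomp : IsCompact (closure Ω) := hb.isCompact_closure
  suffices h : ∃ ρ > 0, ∃ δ > 0, ∀ z ∈ closure Ω ∩ Ω, ∀ s, 0 < s → s ≤ ρ →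
      ∃ w, ball w (δ * s) ⊆ ball z s ∩ Ω by
    obtain ⟨ρ, hρ, δ, hδ, h⟩ := h
    exact ⟨ρ, hρ, δ, hδ, fun z hz => h z ⟨subset_closure hz, hz⟩⟩
  -- Local constants are made uniform by compactness of the closure; minima of ρ and δ handle
  -- unions.
  refine hcomp.induction_on (p := fun A => ∃ ρ > 0, ∃ δ > 0, ∀ z ∈ A ∩ Ω, ∀ s, 0 < s → s ≤ ρ →
      ∃ w, ball w (δ * s) ⊆ ball z s ∩ Ω) ?_ ?_ ?_ ?_
  · exact ⟨1, one_pos, 1, one_pos, by simp⟩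
  · rintro A B hAB ⟨ρ, hρ, δ, hδ, h⟩
    exact ⟨ρ, hρ, δ, hδ, fun z hz => h z ⟨hAB hz.1, hz.2⟩⟩
  · rintro A B ⟨ρ₁, hρ₁, δ₁, hδ₁, h₁⟩ ⟨ρ₂, hρ₂, δ₂, hδ₂, h₂⟩
    refine ⟨min ρ₁ ρ₂, by positivity, min δ₁ δ₂, by positivity, ?_⟩
    rintro z ⟨hz | hz, hzΩ⟩ s hs hsρ
    · obtain ⟨w, hw⟩ := h₁ z ⟨hz, hzΩ⟩ s hs (hsρ.trans (min_le_left _ _))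
      exact ⟨w, (ball_subset_ball (by gcongr; exact min_le_left _ _)).trans hw⟩
    · obtain ⟨w, hw⟩ := h₂ z ⟨hz, hzΩ⟩ s hs (hsρ.trans (min_le_right _ _))
      exact ⟨w, (ball_subset_ball (by gcongr; exact min_le_right _ _)).trans hw⟩
  · intro x hx
    obtain ⟨ρ, hρ, δ, hδ, h⟩ := hΩ.exists_ball_subset_of_mem_closure hx
    refine ⟨ball x ρ, mem_nhdsWithin_of_mem_nhds (ball_mem_nhds _ hρ), ρ, hρ, δ, hδ, ?_⟩
    exact fun z hz => h z ⟨hz.2, hz.1⟩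

/-- For r ≤ ρ the corkscrew ball bounds the measure about x below by a multiple of r^d; for r > ρ
that measure is at least the bound at scale ρ, while the total is |Ω|. The upper bounds ignore the
centre, so z may be arbitrary. -/
theorem IsC2Domain.exists_volume_ball_le {d : ℕ}
    {Ω : Set (EuclideanSpace ℝ (Fin d))} (hΩ : IsC2Domain Ω) (hb : Bornology.IsBounded Ω) :
    ∃ C : ℝ≥0, ∀ x ∈ Ω, ∀ z, ∀ r > 0, volume.restrict Ω (ball z (32 * r)) ≤
      C * volume.restrict Ω (closedBall x r) := by
  obtain ⟨ρ, hρ, δ, hδ, h⟩ := hΩ.exists_forall_ball_subset hb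
  set b := volume (ball (0 : EuclideanSpace ℝ (Fin d)) 1)
  have hb0 : b ≠ 0 := (measure_ball_pos _ _ one_pos).ne'
  have hbt : b ≠ ∞ := measure_ball_lt_top.ne
  have hvol : ∀ (x : EuclideanSpace ℝ (Fin d)) (r : ℝ), 0 < r →
      volume (ball x r) = ENNReal.ofReal r ^ d * b := by
    intro x r hr
    rw [Measure.addHaar_ball_of_pos _ _ hr, finrank_euclideanSpace_fin, ENNReal.ofReal_pow hr.le]
  have hlow : ∀ x ∈ Ω, ∀ s, 0 < s → s ≤ ρ →
      ENNReal.ofReal (δ * s) ^ d * b ≤ volume.restrict Ω (ball x s) := by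
    intro x hx s hs hsρ
    obtain ⟨w, hw⟩ := h x hx s hs hsρ
    rw [Measure.restrict_apply measurableSet_ball, ← hvol w _ (by positivity)]
    exact measure_mono hw
  have hVt : volume Ω ≠ ∞ := hb.measure_lt_top.ne
  have hc : ENNReal.ofReal (δ * ρ) ^ d * b ≠ 0 :=
    mul_ne_zero (pow_ne_zero _ (by simp; positivity)) hb0
  set C₁ : ℝ≥0 := (32 / δ).toNNReal ^ d
  set C₂ : ℝ≥0 := (volume Ω / (ENNReal.ofReal (δ * ρ) ^ d * b)).toNNReal
  have hC₂ : (C₂ : ℝ≥0∞) = volume Ω / (ENNReal.ofReal (δ * ρ) ^ d * b) :=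
    ENNReal.coe_toNNReal (ENNReal.div_ne_top hVt hc)
  refine ⟨max C₁ C₂, fun x hx z r hr => ?_⟩
  rcases le_or_gt r ρ with hrρ | hrρ
  · calc volume.restrict Ω (ball z (32 * r)) ≤ volume (ball z (32 * r)) :=
          Measure.restrict_apply_le _ _
      _ = C₁ * (ENNReal.ofReal (δ * r) ^ d * b) := by
        rw [hvol _ _ (by positivity), ← mul_assoc]
        congr 1
        simp only [C₁, ENNReal.coe_pow]
        rw [← mul_pow]
        congr 1
        change _ = ENNReal.ofReal (32 / δ) * _
        rw [← ENNReal.ofReal_mul (by positivity)]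
        congr 1
        field_simp
      _ ≤ _ := by
        gcongr
        · exact le_max_left _ _
        · exact (hlow x hx r hr hrρ).trans (measure_mono ball_subset_closedBall)
  · calc volume.restrict Ω (ball z (32 * r)) ≤ volume Ω := by
          simpa using measure_mono (μ := volume.restrict Ω) (subset_univ (ball z (32 * r)))
      _ = C₂ * (ENNReal.ofReal (δ * ρ) ^ d * b) := by
        rw [hC₂, ENNReal.div_mul_cancel hc (ENNReal.mul_ne_top (by simp) hbt)]
      _ ≤ _ := by
        gcongr
        · exact le_max_right _ _
        · exact (hlow x hx ρ hρ le_rfl).trans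
            (measure_mono ((ball_subset_ball hrρ.le).trans ball_subset_closedBall))

/-! ### From h to |h|^γ -/

theorem enorm_rpow_norm_sub_rpow_norm_le {E : Type*} [SeminormedAddCommGroup E] {γ : ℝ}
    (hγ0 : 0 < γ) (hγ1 : γ ≤ 1) (a b : E) :
    ‖‖a‖ ^ γ - ‖b‖ ^ γ‖ₑ ≤ ‖a - b‖ₑ ^ γ := by
  have key : ∀ a b : E, ‖a‖ ^ γ - ‖b‖ ^ γ ≤ ‖a - b‖ ^ γ := by
    intro a b
    have h1 : ‖a‖ ≤ ‖a - b‖ + ‖b‖ := by simpa using norm_add_le (a - b) b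
    have h2 := Real.rpow_add_le_add_rpow (norm_nonneg (a - b)) (norm_nonneg b) hγ0.le hγ1
    have h3 := Real.rpow_le_rpow (norm_nonneg a) h1 hγ0.le
    linarith
  have h : |‖a‖ ^ γ - ‖b‖ ^ γ| ≤ ‖a - b‖ ^ γ := by
    refine abs_sub_le_iff.2 ⟨key a b, ?_⟩
    rw [norm_sub_rev]
    exact key b a
  rw [Real.enorm_eq_ofReal_abs, ← ofReal_norm,
    ENNReal.ofReal_rpow_of_nonneg (norm_nonneg _) hγ0.le]
  exact ENNReal.ofReal_le_ofReal h

/-- Dyadic radii are among those in the supremum, and the oscillation of |h|^γ is dominated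
pointwise. Equality almost everywhere is enough, so v may be a measurable representative. -/
theorem dyadicSharp_le_gammaSharp_rpow {d : ℕ} {E : Type*} [NormedAddCommGroup E]
    {Ω : Set (EuclideanSpace ℝ (Fin d))} {γ : ℝ} (hγ0 : 0 < γ) (hγ1 : γ ≤ 1)
    {h : EuclideanSpace ℝ (Fin d) → E} {v : EuclideanSpace ℝ (Fin d) → ℝ}
    (hv : ∀ᵐ x ∂volume.restrict Ω, v x = ‖h x‖ ^ γ) (z : EuclideanSpace ℝ (Fin d)) :
    dyadicSharp (volume.restrict Ω) v z ≤ gammaSharp Ω γ h z ^ γ := by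
  refine iSup_le fun k => ?_
  rw [← ENNReal.rpow_inv_le_iff hγ0, ← one_div]
  refine le_trans ?_ (le_iSup₂ (f := fun (r : ℝ) (_ : 0 < r) =>
    (⨍⁻ x, ⨍⁻ y, ‖h x - h y‖ₑ ^ γ ∂volume.restrict (Metric.ball z r ∩ Ω)
      ∂volume.restrict (Metric.ball z r ∩ Ω)) ^ (1 / γ)) ((2 : ℝ) ^ k) (by positivity))
  rw [Measure.restrict_restrict measurableSet_ball]
  refine ENNReal.rpow_le_rpow ?_ (by positivity)
  set m := volume.restrict (ball z ((2 : ℝ) ^ k) ∩ Ω)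
  have hvm : ∀ᵐ x ∂m, v x = ‖h x‖ ^ γ :=
    ae_mono (Measure.restrict_mono inter_subset_right le_rfl) hv
  simp only [laverage_eq]
  gcongr ?_ / _
  refine lintegral_mono_ae ?_
  filter_upwards [hvm] with x hx
  gcongr ?_ / _
  refine lintegral_mono_ae ?_
  filter_upwards [hvm] with y hy
  rw [hx, hy]
  exact enorm_rpow_norm_sub_rpow_norm_le hγ0 hγ1 _ _

theorem theorem7p1 {d : ℕ} (Ω : Set (EuclideanSpace ℝ (Fin d)))
    (hΩ : IsC2Domain Ω) (hΩb : Bornology.IsBounded Ω)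
    (p : ℝ) (hp : 1 < p) (γ : ℝ) (hγ0 : 0 < γ) (hγ1 : γ ≤ 1) :
    ∃ N : ℝ≥0, ∀ (E : Type*) [NormedAddCommGroup E] [NormedSpace ℝ E]
      (h : EuclideanSpace ℝ (Fin d) → E),
      MemLp h (ENNReal.ofReal p) (volume.restrict Ω) →
      eLpNorm h (ENNReal.ofReal p) (volume.restrict Ω) ≤
        N * eLpNorm (gammaSharp Ω γ h) (ENNReal.ofReal p) (volume.restrict Ω) +
        N * (∫⁻ x in Ω, ‖h x‖ₑ ^ γ) ^ (1 / γ) := by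
  set μ := volume.restrict Ω with hμ
  have hp0 : 0 < p := by linarith
  have : IsFiniteMeasure μ := ⟨by simpa [hμ] using hΩb.measure_lt_top⟩
  obtain ⟨C, hC⟩ := hΩ.exists_volume_ball_le hΩb
  set q := p / γ
  have hq : 1 < q := by rw [one_lt_div hγ0]; linarith
  have hq0 : 0 < q := by linarith
  obtain ⟨N, hN⟩ := exists_lintegral_enorm_rpow_le_dyadicSharp μ
    (ae_restrict_mem hΩ.isOpen.measurableSet) hΩb hC hq
  have hpi : 0 ≤ 1 / p := by positivity
  -- N comes from the scalar inequality, so it does not depend on E.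
  refine ⟨N ^ (1 / p), fun E _ _ h hh => ?_⟩
  have hpt : ENNReal.ofReal p ≠ ∞ := ENNReal.ofReal_ne_top
  have hp00 : ENNReal.ofReal p ≠ 0 := by simpa using hp0
  have hptr : (ENNReal.ofReal p).toReal = p := ENNReal.toReal_ofReal hp0.le
  have hvae : AEMeasurable (fun x => ‖h x‖ ^ γ) μ := hh.1.norm.aemeasurable.pow_const γ
  set v := hvae.mk _
  have hv : ∀ᵐ x ∂μ, v x = ‖h x‖ ^ γ := hvae.ae_eq_mk.symm
  have hve : ∀ᵐ x ∂μ, ‖v x‖ₑ = ‖h x‖ₑ ^ γ := by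
    filter_upwards [hv] with x hx
    rw [hx, Real.enorm_of_nonneg (by positivity), ← ofReal_norm,
      ENNReal.ofReal_rpow_of_nonneg (norm_nonneg _) hγ0.le]
  have hγq : γ * q = p := mul_div_cancel₀ p hγ0.ne'
  have e1 : ∫⁻ x, ‖v x‖ₑ ^ q ∂μ = ∫⁻ x, ‖h x‖ₑ ^ p ∂μ := by
    refine lintegral_congr_ae ?_
    filter_upwards [hve] with x hx
    rw [hx, ← ENNReal.rpow_mul, hγq]
  have e2 : ∫⁻ x, ‖v x‖ₑ ∂μ = ∫⁻ x, ‖h x‖ₑ ^ γ ∂μ := lintegral_congr_ae hve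
  have hhp : ∫⁻ x, ‖h x‖ₑ ^ p ∂μ ≠ ∞ := by
    have := lintegral_rpow_enorm_lt_top_of_eLpNorm_lt_top hp00 hpt hh.2
    rw [hptr] at this
    exact this.ne
  have hhγ : ∫⁻ x, ‖h x‖ₑ ^ γ ∂μ ≠ ∞ := by
    -- γ ≤ 1 < p and μ is finite, so L_p embeds in L_γ.
    have h1 : MemLp h (ENNReal.ofReal γ) μ :=
      hh.mono_exponent (ENNReal.ofReal_le_ofReal (by linarith))
    have := lintegral_rpow_enorm_lt_top_of_eLpNorm_lt_top (by simpa using hγ0)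
      ENNReal.ofReal_ne_top h1.2
    rw [ENNReal.toReal_ofReal hγ0.le] at this
    exact this.ne
  have hmain := hN v hvae.measurable_mk (e2 ▸ hhγ) (e1 ▸ hhp)
  rw [e1, e2] at hmain
  -- Monotonicity of the lower integral requires no measurability of h^#_γ.
  have hS : ∫⁻ x, dyadicSharp μ v x ^ q ∂μ ≤ ∫⁻ x, gammaSharp Ω γ h x ^ p ∂μ := by
    refine lintegral_mono fun x => ?_
    rw [← hγq, ENNReal.rpow_mul]
    exact ENNReal.rpow_le_rpow (dyadicSharp_le_gammaSharp_rpow hγ0 hγ1 hv x) hq0.le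
  rw [eLpNorm_eq_lintegral_rpow_enorm_toReal hp00 hpt,
    eLpNorm_eq_lintegral_rpow_enorm_toReal hp00 hpt, hptr]
  simp only [enorm_eq_self]
  set S := ∫⁻ x, gammaSharp Ω γ h x ^ p ∂μ
  set M := ∫⁻ x, ‖h x‖ₑ ^ γ ∂μ
  have hM : (M ^ q) ^ (1 / p) = M ^ (1 / γ) := by
    rw [← ENNReal.rpow_mul]
    congr 1
    simp only [q]
    field_simp
  have hadd : ∀ a b : ℝ≥0∞, (a + b) ^ (1 / p) ≤ a ^ (1 / p) + b ^ (1 / p) := fun a b =>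
    ENNReal.rpow_add_le_add_rpow a b hpi (by rw [div_le_one hp0]; exact hp.le)
  calc (∫⁻ x, ‖h x‖ₑ ^ p ∂μ) ^ (1 / p) ≤ (N * S + N * M ^ q) ^ (1 / p) := by
        gcongr
        exact hmain.trans (by gcongr)
    _ ≤ (N * S) ^ (1 / p) + (N * M ^ q) ^ (1 / p) := hadd _ _
    _ = (N ^ (1 / p) : ℝ≥0) * S ^ (1 / p) + (N ^ (1 / p) : ℝ≥0) * M ^ (1 / γ) := by
      rw [ENNReal.mul_rpow_of_nonneg _ _ hpi, ENNReal.mul_rpow_of_nonneg _ _ hpi, hM,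
        ENNReal.coe_rpow_of_nonneg _ hpi]
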